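/- Let $\mathbf M$ be a finite algebra whose type is finite (finitely many operation symbols), and let $\mathcal A=\mathbb{ISP}(\mathbf M)$ be the class of (nonempty) algebras isomorphic to subalgebras of powers of $\mathbf M$. Let $\utilde{M}=\langle M;G\cup H\cup R,\iota\rangle$, where $\iota$ is the discrete topology and $G$, $H$, $R$ are sets of, respectively, algebraic operations, algebraic partial operations with nonempty domain, and nonempty algebraic relations on $\mathbf M$ (algebraic means: the operation is a homomorphism defined on a subalgebra of a finite power of $\mathbf M$, the relation is such a subalgebra). Let $\mathcal X=\mathbb{IS}_c\mathbb P(\utilde M)$ be the category of topological structures isomorphic to closed substructures of nonempty powers of $\utilde M$ (the empty substructure is allowed if there are no constants), with the continuous structure preserving maps as arrows; let $X\mapsto X^\flat$ be the functor that forgets the topology, from $\mathcal X$ to the category $\mathbb{ISP}(\utilde M^\flat)$ of structures isomorphic to substructures of nonempty powers of $\utilde M^\flat$, with the structure preserving maps as arrows. For $\mathbf A\in\mathcal A$ let $\mathbf A^*=\mathcal A(\mathbf A,\mathbf M)\in\mathcal X$, with the structure and topology inherited from $\utilde M^A$; for $X\in\mathcal X$ let $X_*=\mathcal X(X,\utilde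 M)\in\mathcal A$. $\utilde M$ yields a *full duality* for $\mathcal A$ if the evaluation maps $\mathbf A\to(\mathbf A^*)_*$ ($\mathbf A\in\mathcal A$) and $X\to(X_*)^*$ ($X\in\mathcal X$) are all isomorphisms; the duality is *strong* if moreover $\utilde M$ is injective in $\mathcal X$ with respect to embeddings; a strong duality is *logarithmic* if coproducts in $\mathcal X$ are direct unions, that is, disjoint unions with the constants (the elements of the least substructure) amalgamated, in which each relation and each (graph of an) operation is the union of those of the two factors. The *natural extension* $\mathbf A^\delta$ of $\mathbf A\in\mathcal A$ is the topological algebra obtained as the closure of $\{(\phi\mapsto\phi(a)) : a\in A\}$ in $\mathbf M^{\mathbf A^*}$; its topology $\iota$ is induced by the product of the discrete topologies. The topology $\delta$ on $\mathbf A^\delta$ is generated by the sets $O_f=\{x\in\mathbf A^\delta : x \text{ extends } f\}$, where $f$ runs over the continuous structure preserving maps $f\colon D\to\utilde M$ with $D$ a closed substructure of $\mathbf A^*$. **Theorem.** Assume that $\mathbf M$ is of finite type and that $\utilde M$ yields a full duality for $\mathcal A$, and let $\mathbf A,\mathbf B\in\mathcal A$. Then the coproduct $\mathbf A^*\amalg\mathbf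 B^*$ in $\mathcal X$ and the coproduct $(\mathbf A^*)^\flat\amalg(\mathbf B^*)^\flat$ in $\mathbb{ISP}(\utilde M^\flat)$ exist, and $$(\mathbf A\times\mathbf B)^\delta\simeq\mathbf A^\delta\times\mathbf B^\delta\ \text{ as topological algebras (for } \iota)\iff(\mathbf A^*\amalg\mathbf B^*)^\flat\simeq(\mathbf A^*)^\flat\amalg(\mathbf B^*)^\flat .$$ If moreover the duality yielded by $\utilde M$ is logarithmic, then both of these conditions hold, and there is an algebra isomorphism between $(\mathbf A\times\mathbf B)^\delta$ and $\mathbf A^\delta\times\mathbf B^\delta$ which is a homeomorphism both for the topologies $\iota$ and for the topologies $\delta$ (the product carrying the respective product topologies). -/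

import Mathlib

open CategoryTheory CategoryTheory.Limits FirstOrder

universe u v w

namespace NaturalDuality

/-! ### Algebras: powers, products, the prevariety `ISP(M)`

An algebra of type `L` is an `L`-structure for an algebraic language `L` (no relation symbols). -/

section Algebras

variable {L : FirstOrder.Language.{v, w}}

/-- The power `M ^ S`, with pointwise operations. -/
instance piStructure (S : Type*) (M : Type*) [L.Structure M] : L.Structure (S → M) where
  funMap f xs := fun s => Language.Structure.funMap f (fun i => xs i s)
  RelMap r xs := ∀ s, Language.Structure.RelMap r (fun i => xs i s)

/-- The direct product `A × B`, with componentwise operations. -/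
instance prodStructure (A B : Type*) [L.Structure A] [L.Structure B] : L.Structure (A × B) where
  funMap f xs := (Language.Structure.funMap f (fun i => (xs i).1),
    Language.Structure.funMap f (fun i => (xs i).2))
  RelMap r xs := Language.Structure.RelMap r (fun i => (xs i).1) ∧
    Language.Structure.RelMap r (fun i => (xs i).2)

variable (L)

/-- `A` belongs to `ISP(M)`: it is nonempty (as algebras are) and isomorphic to a subalgebra of a
power of `M`. -/
def MemISP (M : Type u) [L.Structure M] (A : Type u) [L.Structure A] : Prop :=
  Nonempty A ∧ ∃ S : Type u, Nonempty (A ↪[L] (S → M))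

/-- The type of the algebras is finite: there are finitely many operation symbols. -/
def FiniteType : Prop := Finite (Σ n, L.Functions n)

end Algebras

/-! ### The structure `⟨M; G ∪ H ∪ R⟩` -/

/-- A set `G ∪ H` of algebraic (total or partial) operations and a set `R` of algebraic relations
on `M`. An algebraic relation of arity `n` is a nonempty subalgebra of `M ^ n`; an algebraic partial
operation of arity `n` is a homomorphism to `M` from a nonempty subalgebra of `M ^ n`, and it is a
total operation (a member of `G`) when this subalgebra is `M ^ n`. Operations of arity `0` are the
constants. -/
structure AlterEgo (L : FirstOrder.Language.{v, w}) (M : Type u) [L.Structure M] where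
  Op : Type u
  opArity : Op → ℕ
  opDom : ∀ o, L.Substructure (Fin (opArity o) → M)
  opDom_nonempty : ∀ o, (opDom o : Set (Fin (opArity o) → M)).Nonempty
  opHom : ∀ o, opDom o →[L] M
  Rel : Type u
  relArity : Rel → ℕ
  rel : ∀ r, L.Substructure (Fin (relArity r) → M)
  rel_nonempty : ∀ r, (rel r : Set (Fin (relArity r) → M)).Nonempty

variable {L : FirstOrder.Language.{v, w}} {M : Type u} [L.Structure M]

/-- A structure of the same type as the alter ego: partial operations and relations. -/
class Str (E : AlterEgo L M) (X : Type*) where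
  op : ∀ o : E.Op, (Fin (E.opArity o) → X) →. X
  rel : ∀ r : E.Rel, Set (Fin (E.relArity r) → X)

namespace Str

variable (E : AlterEgo L M)

/-- The structure on `M` itself. -/
instance self : Str E M where
  op o xs := ⟨xs ∈ E.opDom o, fun h => E.opHom o ⟨xs, h⟩⟩
  rel r := E.rel r

/-- The power `X ^ S`: operations are pointwise, defined where all coordinates are defined, and
relations are pointwise. -/
instance pi (S : Type*) (X : Type*) [Str E X] : Str E (S → X) where
  op o xs := ⟨∀ s, (op (E := E) o (fun i => xs i s)).Dom,
    fun h s => (op (E := E) o (fun i => xs i s)).get (h s)⟩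
  rel r := {xs | ∀ s, (fun i => xs i s) ∈ rel (E := E) (X := X) r}

variable {X Y Z : Type*} [Str E X] [Str E Y] [Str E Z]

/-- Structure preserving maps: if `op o xs` is defined, then so is `op o (f ∘ xs)`, and `f` maps the
former to the latter; relations are preserved. -/
structure IsMorphism (f : X → Y) : Prop where
  map_op : ∀ (o : E.Op) (xs : Fin (E.opArity o) → X) (x : X),
    x ∈ op (E := E) o xs → f x ∈ op (E := E) o (f ∘ xs)
  map_rel : ∀ (r : E.Rel) (xs : Fin (E.relArity r) → X),
    xs ∈ rel (E := E) r → f ∘ xs ∈ rel (E := E) r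

/-- Embeddings, i.e. isomorphisms onto a substructure: injective morphisms that reflect the domains
of the operations and the relations. -/
structure IsEmbedding (f : X → Y) : Prop extends IsMorphism E f where
  injective : Function.Injective f
  reflect_dom : ∀ (o : E.Op) (xs : Fin (E.opArity o) → X),
    (op (E := E) o (f ∘ xs)).Dom → (op (E := E) o xs).Dom
  reflect_rel : ∀ (r : E.Rel) (xs : Fin (E.relArity r) → X),
    f ∘ xs ∈ rel (E := E) r → xs ∈ rel (E := E) r

/-- Substructures: subsets closed under the operations, where these are defined. They contain the
constants, and may be empty if there are none. -/
def IsSubstructure (D : Set X) : Prop :=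
  ∀ (o : E.Op) (xs : Fin (E.opArity o) → X) (x : X),
    (∀ i, xs i ∈ D) → x ∈ op (E := E) o xs → x ∈ D

/-- A map `f : D → Y` is a morphism on the substructure `D` of `X` (with the structure induced
by `X`). -/
structure IsMorphismOn (D : Set X) (f : D → Y) : Prop where
  map_op : ∀ (o : E.Op) (xs : Fin (E.opArity o) → D) (x : D),
    (x : X) ∈ op (E := E) o (fun i => (xs i : X)) → f x ∈ op (E := E) o (f ∘ xs)
  map_rel : ∀ (r : E.Rel) (xs : Fin (E.relArity r) → D),
    (fun i => (xs i : X)) ∈ rel (E := E) r → f ∘ xs ∈ rel (E := E) r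

variable (X) in
/-- The constants of `X`: the smallest substructure, which consists of the values of the nullary
operations and of what they generate. -/
def constants : Set X := {x | ∀ D : Set X, IsSubstructure E D → x ∈ D}

variable {E}

/-- `C`, with the maps `i : X → C` and `j : Y → C`, is the direct union of `X` and `Y`: the disjoint
union of `X` and `Y` with the constants amalgamated, where each operation (as a graph) and each
relation of `C` is the union of those of `X` and `Y`. -/
structure IsDirectUnion (i : X → Z) (j : Y → Z) : Prop where
  left : IsEmbedding E i
  right : IsEmbedding E j
  cover : ∀ z, z ∈ Set.range i ∨ z ∈ Set.range j
  inter : ∀ x y, i x = j y → x ∈ constants E X ∧ y ∈ constants E Y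
  op_cases : ∀ (o : E.Op) (zs : Fin (E.opArity o) → Z) (z : Z), z ∈ op (E := E) o zs →
    (∃ xs x, x ∈ op (E := E) o xs ∧ i ∘ xs = zs ∧ i x = z) ∨
    (∃ ys y, y ∈ op (E := E) o ys ∧ j ∘ ys = zs ∧ j y = z)
  rel_cases : ∀ (r : E.Rel) (zs : Fin (E.relArity r) → Z), zs ∈ rel (E := E) r →
    (∃ xs, xs ∈ rel (E := E) r ∧ i ∘ xs = zs) ∨
    (∃ ys, ys ∈ rel (E := E) r ∧ j ∘ ys = zs)

variable (E)

theorem IsMorphism.id : IsMorphism E (id : X → X) := ⟨fun _ _ _ h => h, fun _ _ h => h⟩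

theorem IsMorphism.comp {g : Y → Z} {f : X → Y} (hg : IsMorphism E g) (hf : IsMorphism E f) :
    IsMorphism E (g ∘ f) :=
  ⟨fun o xs x h => hg.map_op o _ _ (hf.map_op o xs x h),
   fun r xs h => hg.map_rel r _ (hf.map_rel r xs h)⟩

/-- `x ∈ op o xs` in a power means that it holds in every coordinate. -/
theorem mem_op_pi {S : Type*} (o : E.Op) (xs : Fin (E.opArity o) → (S → X)) (x : S → X) :
    x ∈ op (E := E) o xs ↔ ∀ s, x s ∈ op (E := E) o (fun i => xs i s) := by
  constructor
  · rintro ⟨h, rfl⟩ s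
    exact ⟨h s, rfl⟩
  · intro h
    exact ⟨fun s => (h s).1, funext fun s => (h s).2⟩

end Str

/-! ### The categories `IS_cP(M̃)` and `ISP(M̃^♭)` -/

/-- The objects of `𝒳 = IS_cP(M̃)`: topological structures that are isomorphic to a closed
substructure of a nonempty power of `M̃`. -/
structure TopStr (E : AlterEgo L M) [TopologicalSpace M] where
  carrier : Type u
  [top : TopologicalSpace carrier]
  [str : Str E carrier]
  mem : ∃ S : Type u, Nonempty S ∧ ∃ e : carrier → (S → M),
    Topology.IsClosedEmbedding e ∧ Str.IsEmbedding E e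

/-- The objects of `ISP(M̃^♭)`: structures that are isomorphic to a substructure of a nonempty power
of `M̃^♭`. -/
structure FlatStr (E : AlterEgo L M) where
  carrier : Type u
  [str : Str E carrier]
  mem : ∃ S : Type u, Nonempty S ∧ ∃ e : carrier → (S → M), Str.IsEmbedding E e

instance (E : AlterEgo L M) [TopologicalSpace M] : CoeSort (TopStr E) (Type u) := ⟨TopStr.carrier⟩
instance (E : AlterEgo L M) : CoeSort (FlatStr E) (Type u) := ⟨FlatStr.carrier⟩

attribute [instance] TopStr.top TopStr.str FlatStr.str

section Categories

variable {E : AlterEgo L M}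

/-- Arrows of `IS_cP(M̃)`: continuous structure preserving maps. -/
@[ext] structure TopStr.Hom [TopologicalSpace M] (X Y : TopStr E) where
  toFun : X → Y
  isMorphism : Str.IsMorphism E toFun
  continuous : Continuous toFun

/-- Arrows of `ISP(M̃^♭)`: structure preserving maps. -/
@[ext] structure FlatStr.Hom (X Y : FlatStr E) where
  toFun : X → Y
  isMorphism : Str.IsMorphism E toFun

instance [TopologicalSpace M] : Category (TopStr E) where
  Hom X Y := TopStr.Hom X Y
  id X := ⟨id, Str.IsMorphism.id E, continuous_id⟩
  comp f g := ⟨g.toFun ∘ f.toFun, g.isMorphism.comp E f.isMorphism,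
    g.continuous.comp f.continuous⟩

instance : Category (FlatStr E) where
  Hom X Y := FlatStr.Hom X Y
  id X := ⟨id, Str.IsMorphism.id E⟩
  comp f g := ⟨g.toFun ∘ f.toFun, g.isMorphism.comp E f.isMorphism⟩

/-- The functor `X ↦ X^♭` that forgets the topology. -/
def flat [TopologicalSpace M] : TopStr E ⥤ FlatStr E where
  obj X := ⟨X, let ⟨S, hS, e, _, he⟩ := X.mem; ⟨S, hS, e, he⟩⟩
  map f := ⟨f.toFun, f.isMorphism⟩

end Categories

/-! ### The dual functors -/

section Duals

theorem continuous_funMap [TopologicalSpace M] [DiscreteTopology M] {n : ℕ} (f : L.Functions n) (S : Type*) :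
    Continuous (fun xs : Fin n → S → M => (Language.Structure.funMap f xs : S → M)) :=
  continuous_pi fun s =>
    (continuous_of_discreteTopology (f := fun y : Fin n → M => Language.Structure.funMap f y)).comp
      (continuous_pi fun i => (continuous_apply s).comp (continuous_apply i))

variable (E : AlterEgo L M) [L.IsAlgebraic]

/-- `A^* = 𝒜(A, M)` as a structure: operations and relations are pointwise, as in `M̃ ^ A`. -/
instance homStr (A : Type*) [L.Structure A] : Str E (A →[L] M) where
  op o φs := ⟨∀ a, (fun i => φs i a) ∈ E.opDom o, fun h =>
    { toFun := fun a => E.opHom o ⟨fun i => φs i a, h a⟩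
      map_fun' := by
        intro n f x
        refine Eq.trans ?_ ((E.opHom o).map_fun f
          (fun k => (⟨fun i => φs i (x k), h (x k)⟩ : E.opDom o)))
        congr 1
        apply Subtype.ext
        funext i
        exact (φs i).map_fun f x
      map_rel' := fun r => isEmptyElim r }⟩
  rel r := {φs | ∀ a, (fun i => φs i a) ∈ E.rel r}

/-- `A^*` carries the topology induced by the product topology of `M ^ A`. -/
instance homTop [TopologicalSpace M] (A : Type*) [L.Structure A] : TopologicalSpace (A →[L] M) :=
  TopologicalSpace.induced (fun φ a => φ a) inferInstance

theorem mem_op_hom {A : Type*} [L.Structure A] (o : E.Op) (φs : Fin (E.opArity o) → (A →[L] M))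
    (φ : A →[L] M) :
    φ ∈ Str.op (E := E) o φs ↔ ∀ a, φ a ∈ Str.op (E := E) o (fun i => φs i a) := by
  constructor
  · rintro ⟨h, rfl⟩ a
    exact ⟨h a, rfl⟩
  · intro h
    exact ⟨fun a => (h a).1, Language.Hom.ext fun a => (h a).2⟩

theorem hom_isEmbedding (A : Type*) [L.Structure A] :
    Str.IsEmbedding E (fun (φ : A →[L] M) (a : A) => φ a) where
  map_op o φs φ h := (Str.mem_op_pi E o _ _).2 ((mem_op_hom E o φs φ).1 h)
  map_rel _ _ h := h
  injective _ _ h := DFunLike.coe_injective h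
  reflect_dom _ _ h := h
  reflect_rel _ _ h := h

variable [TopologicalSpace M] [DiscreteTopology M]

theorem hom_isClosedEmbedding (A : Type*) [L.Structure A] :
    Topology.IsClosedEmbedding (fun (φ : A →[L] M) (a : A) => φ a) := by
  refine ⟨⟨⟨rfl⟩, fun _ _ h => DFunLike.coe_injective h⟩, ?_⟩
  have : Set.range (fun (φ : A →[L] M) (a : A) => φ a) =
      ⋂ (n : ℕ) (f : L.Functions n) (x : Fin n → A),
        {g : A → M | g (Language.Structure.funMap f x) = Language.Structure.funMap f (g ∘ x)} := by
    ext g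
    simp only [Set.mem_range, Set.mem_iInter, Set.mem_ofPred_eq]
    constructor
    · rintro ⟨φ, rfl⟩ n f x
      exact φ.map_fun f x
    · intro h
      exact ⟨⟨g, fun f x => h _ f x, fun r => isEmptyElim r⟩, rfl⟩
  rw [this]
  refine isClosed_iInter fun n => isClosed_iInter fun f => isClosed_iInter fun x => ?_
  refine isClosed_eq (continuous_apply _) ?_
  exact (continuous_of_discreteTopology (f := fun y : Fin n → M =>
    Language.Structure.funMap f y)).comp (continuous_pi fun i => continuous_apply (x i))

/-- The dual `A^* = 𝒜(A, M)` of a nonempty algebra `A`, as an object of `𝒳`. -/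
def dual (A : Type u) [L.Structure A] [Nonempty A] : TopStr E where
  carrier := A →[L] M
  mem := ⟨A, inferInstance, _, hom_isClosedEmbedding A, hom_isEmbedding E A⟩

/-- The object `M̃` of `𝒳`. -/
def TopStr.self : TopStr E where
  carrier := M
  mem := by
    refine ⟨PUnit, inferInstance, fun m _ => m, ?_, ?_⟩
    · exact (Homeomorph.funUnique PUnit.{u + 1} M).symm.isClosedEmbedding
    · refine ⟨⟨fun o xs x h => (Str.mem_op_pi E o _ _).2 fun _ => h, fun r xs h _ => h⟩,
        fun x y h => congrFun h PUnit.unit, fun o xs h => h PUnit.unit,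
        fun r xs h => h PUnit.unit⟩

variable {E}

/-- The dual `X_* = 𝒳(X, M̃)` of an object `X` of `𝒳`, as a subalgebra of `M ^ X`. -/
def TopStr.dual (X : TopStr E) : L.Substructure (X → M) where
  carrier := {f | Str.IsMorphism E f ∧ Continuous f}
  fun_mem := by
    intro n f gs hg
    refine ⟨⟨?_, ?_⟩, ?_⟩
    · intro o xs x hx
      have h : ∀ i, ∃ hd : gs i ∘ xs ∈ E.opDom o, E.opHom o ⟨gs i ∘ xs, hd⟩ = gs i x :=
        fun i => (hg i).1.map_op o xs x hx
      choose hd hv using h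
      refine ⟨(E.opDom o).fun_mem f (fun i => gs i ∘ xs) hd, ?_⟩
      have := (E.opHom o).map_fun f (fun i => (⟨gs i ∘ xs, hd i⟩ : E.opDom o))
      refine this.trans ?_
      change Language.Structure.funMap f _ = Language.Structure.funMap f (fun i => gs i x)
      congr 1
      funext i
      exact hv i
    · intro r xs hx
      exact (E.rel r).fun_mem f (fun i => gs i ∘ xs) fun i => (hg i).1.map_rel r xs hx
    · exact (continuous_of_discreteTopology (f := fun y : Fin n → M =>
        Language.Structure.funMap f y)).comp (continuous_pi fun i => (hg i).2)

instance (X : TopStr E) : Nonempty X.dual := by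
  obtain ⟨S, ⟨s⟩, e, hc, he⟩ := X.mem
  refine ⟨⟨fun x => e x s, ⟨?_, ?_⟩, (continuous_apply s).comp hc.continuous⟩⟩
  · exact fun o xs x h => (Str.mem_op_pi E o _ _).1 (he.map_op o xs x h) s
  · exact fun r xs h => he.map_rel r xs h s

variable (E)

/-- The evaluation homomorphism `e_A : A → (A^*)_*`. -/
def evalHom (A : Type u) [L.Structure A] [Nonempty A] : A →[L] (dual E A).dual where
  toFun a := ⟨fun φ : A →[L] M => φ a, ⟨fun o φs φ h => (mem_op_hom E o φs φ).1 h a,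
    fun _ _ h => h a⟩, (continuous_apply a).comp continuous_induced_dom⟩
  map_fun' f x := Subtype.ext (funext fun φ : A →[L] M => φ.map_fun f x)
  map_rel' r := isEmptyElim r

variable {E}

/-- The evaluation arrow `ε_X : X → (X_*)^*`. -/
def TopStr.eval (X : TopStr E) : X ⟶ NaturalDuality.dual E X.dual where
  toFun x := (⟨fun f => f.1 x, fun _ _ => rfl, fun r => isEmptyElim r⟩ : X.dual →[L] M)
  isMorphism :=
    ⟨fun o xs x h => (mem_op_hom E o _ _).2 fun f => f.2.1.map_op o xs x h,
     fun r xs h f => f.2.1.map_rel r xs h⟩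
  continuous := continuous_induced_rng.2 (continuous_pi fun f => f.2.2)

variable (E)

/-- `M̃` yields a full duality for `𝒜 = ISP(M)`: the evaluation maps are isomorphisms, for all
algebras of `𝒜` (the map is then a bijective homomorphism) and for all objects of `𝒳`. -/
structure YieldsFullDuality : Prop where
  eval_bijective : ∀ (A : Type u) [L.Structure A] [Nonempty A], MemISP L M A →
    Function.Bijective (evalHom E A)
  eval_isIso : ∀ X : TopStr E, IsIso X.eval

/-- `M̃` is injective in `𝒳` (with respect to embeddings). -/
def IsInjective : Prop :=
  ∀ (X Y : TopStr E) (i : X ⟶ Y) (f : X ⟶ TopStr.self E), Str.IsEmbedding E i.toFun →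
    ∃ g : Y ⟶ TopStr.self E, i ≫ g = f

/-- `M̃` yields a strong duality: a full duality with `M̃` injective in `𝒳`. -/
structure YieldsStrongDuality : Prop extends YieldsFullDuality E where
  injective : IsInjective E

/-- `M̃` yields a logarithmic duality: a strong duality such that the coproducts in `𝒳` are
realized as direct unions. -/
structure YieldsLogarithmicDuality : Prop extends YieldsStrongDuality E where
  isDirectUnion : ∀ (X Y C : TopStr E) (i : X ⟶ C) (j : Y ⟶ C),
    Nonempty (IsColimit (BinaryCofan.mk i j)) → Str.IsDirectUnion (E := E) i.toFun j.toFun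

end Duals

/-! ### Natural extensions and their topologies -/

section NaturalExtension

variable (L M) [TopologicalSpace M] [DiscreteTopology M]

/-- The natural extension `A^δ`: the closure in `M ^ (A^*)` of the set of the evaluation maps
`φ ↦ φ a`, as a subalgebra of `M ^ (A^*)`. The topology `ι` is the subspace topology. -/
def natExt (A : Type u) [L.Structure A] : L.Substructure ((A →[L] M) → M) where
  carrier := closure (Set.range fun (a : A) (φ : A →[L] M) => φ a)
  fun_mem := by
    intro n f xs hxs
    have h1 : xs ∈ closure (Set.univ.pi fun _ : Fin n =>
        Set.range fun (a : A) (φ : A →[L] M) => φ a) := by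
      rw [closure_pi_set]
      exact fun i _ => hxs i
    refine map_mem_closure (continuous_funMap f (A →[L] M)) h1 ?_
    intro ys hys
    choose a ha using fun i => hys i (Set.mem_univ i)
    refine ⟨Language.Structure.funMap f a, ?_⟩
    funext φ
    refine (φ.map_fun f a).trans ?_
    change _ = Language.Structure.funMap f (fun i => ys i φ)
    congr 1
    funext i
    exact congrFun (ha i) φ

variable {L M}

/-- The set `O_f` of the `x ∈ A^δ` that extend the map `f : D → M`, where `D ⊆ A^*`. -/
def extending {A : Type u} [L.Structure A] (D : Set (A →[L] M)) (f : D → M) : Set (natExt L M A) :=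
  {x | ∀ φ : D, x.1 φ = f φ}

variable (E : AlterEgo L M) [L.IsAlgebraic]

/-- The topology `δ` on `A^δ`, generated by the sets `O_f`, where `f` runs through the partial
morphisms from `A^*` to `M̃`, i.e. the continuous structure preserving maps to `M̃` whose domain is a
closed substructure of `A^*`. -/
abbrev deltaTopology (A : Type u) [L.Structure A] : TopologicalSpace (natExt L M A) :=
  TopologicalSpace.generateFrom
    {U | ∃ (D : Set (A →[L] M)) (f : D → M), IsClosed D ∧ Str.IsSubstructure E D ∧
      Str.IsMorphismOn E D f ∧ Continuous f ∧ U = extending D f}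

end NaturalExtension

end NaturalDuality

open NaturalDuality

/-! Both sides are governed by maps out of $\mathbf A^*$ that need not be continuous. Under a full
duality $\mathbf A^\delta$ consists of all structure preserving maps $\mathbf A^*\to\utilde M$
(`mem_natExt_iff`). Preservation is a closed condition that holds at the evaluations. Conversely,
the restriction of such a map to finitely many $\phi$ comes from a map on the finite dual of a
finite quotient of $\mathbf A$, where continuity is automatic and the duality supplies an element.

Dualizing products shows that $(\mathbf A\times\mathbf B)^*$ is the coproduct in $\mathcal X$
(`nonempty_isColimit_dualCofan`). The coproduct of $(\mathbf A^*)^\flat$ and $(\mathbf B^*)^\flat$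
is the structure of continuous homomorphisms $\mathbf A^\delta\times\mathbf B^\delta\to\mathbf M$
(`nonempty_isColimit_contDualCofan`). A pair of morphisms to $\utilde M$ is a point of $\mathbf
A^\delta\times\mathbf B^\delta$, and evaluation there extends both. Extensions are unique because
the evaluations generate: a continuous homomorphism depends on finitely many coordinates, which
reduces the claim to finite algebras (`mem_of_isSubstructure_of_continuous`).

The equivalence then compares $((\mathbf A\times\mathbf B)^*)^\flat$ with this structure. Composing
with a homeomorphic isomorphism of algebras gives an isomorphism of structures. In the other
direction, unique extension of morphisms makes a continuous homomorphism between compact Hausdorff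
algebras bijective, hence a homeomorphism (`exists_equiv_of_existsUnique`).

In a direct union, morphisms glue uniquely without any continuity, so the logarithmic case yields
the isomorphism. Basic $\delta$-open sets are transported by taking images and preimages of the
domains of partial morphisms (`isHomeomorph_deltaTopology`). -/

namespace NaturalDuality

variable {L : FirstOrder.Language.{v, w}} {M : Type u} [L.Structure M]

/-! ### Substructures, embeddings and gluing for partial structures -/

namespace Str

variable {E : AlterEgo L M} {X Y : Type*} [Str E X] [Str E Y]

/-- The structure induced on a substructure. -/
@[reducible] def sub {D : Set X} (hD : IsSubstructure E D) : Str E D where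
  op o xs := ⟨(op (E := E) o (fun i => (xs i : X))).Dom,
    fun h => ⟨(op (E := E) o (fun i => (xs i : X))).get h,
      hD o _ _ (fun i => (xs i).2) (Part.get_mem h)⟩⟩
  rel r := {xs | (fun i => (xs i : X)) ∈ rel (E := E) r}

theorem mem_op_sub {D : Set X} (hD : IsSubstructure E D) (o : E.Op)
    (xs : Fin (E.opArity o) → D) (x : D) :
    x ∈ (sub hD).op o xs ↔ (x : X) ∈ op (E := E) o (fun i => (xs i : X)) := by
  constructor
  · rintro ⟨h, rfl⟩
    exact ⟨h, rfl⟩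
  · rintro ⟨h, hx⟩
    exact ⟨h, Subtype.ext hx⟩

theorem isEmbedding_sub {D : Set X} (hD : IsSubstructure E D) :
    @IsEmbedding L M _ E D X (sub hD) _ (Subtype.val : D → X) :=
  letI := sub hD
  { map_op := fun o xs x h => (mem_op_sub hD o xs x).1 h
    map_rel := fun _ _ h => h
    injective := Subtype.val_injective
    reflect_dom := fun _ _ h => h
    reflect_rel := fun _ _ h => h }

theorem IsEmbedding.comp {Z : Type*} [Str E Z] {g : Y → Z} {f : X → Y} (hg : IsEmbedding E g)
    (hf : IsEmbedding E f) : IsEmbedding E (g ∘ f) where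
  toIsMorphism := hg.toIsMorphism.comp E hf.toIsMorphism
  injective := hg.injective.comp hf.injective
  reflect_dom o xs h := hf.reflect_dom o xs (hg.reflect_dom o _ h)
  reflect_rel r xs h := hf.reflect_rel r xs (hg.reflect_rel r _ h)

/-- Reflection of domains provides some value of the operation at `xs`; operations are single-valued
and `f` is injective, so that value is `x`. -/
theorem IsEmbedding.mem_op {f : X → Y} (hf : IsEmbedding E f) {o : E.Op}
    {xs : Fin (E.opArity o) → X} {x : X} : f x ∈ op (E := E) o (f ∘ xs) ↔ x ∈ op (E := E) o xs := by
  refine ⟨fun h => ?_, hf.map_op o xs x⟩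
  have hd := hf.reflect_dom o xs h.1
  have := hf.injective (Part.mem_unique h (hf.map_op o xs _ (Part.get_mem hd)))
  exact this ▸ Part.get_mem hd

/-- A map whose composition with an embedding is a morphism is a morphism. -/
theorem IsEmbedding.of_comp {Z : Type*} [Str E Z] {g : Y → Z} {f : X → Y} (hg : IsEmbedding E g)
    (h : IsMorphism E (g ∘ f)) : IsMorphism E f :=
  ⟨fun o xs x hx => hg.mem_op.1 (h.map_op o xs x hx),
    fun r xs hx => hg.reflect_rel r _ (h.map_rel r xs hx)⟩

theorem IsSubstructure.preimage {f : X → Y} (hf : IsMorphism E f) {D : Set Y}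
    (hD : IsSubstructure E D) : IsSubstructure E (f ⁻¹' D) :=
  fun o xs x h hx => hD o _ _ h (hf.map_op o xs x hx)

theorem IsSubstructure.image {f : X → Y} (hf : IsEmbedding E f) {D : Set X}
    (hD : IsSubstructure E D) : IsSubstructure E (f '' D) := by
  intro o ys y h hy
  choose xs hxs hf' using h
  obtain rfl : f ∘ xs = ys := funext hf'
  have hd := hf.reflect_dom o xs hy.1
  exact ⟨_, hD o xs _ hxs (Part.get_mem hd),
    Part.mem_unique (hf.map_op o xs _ (Part.get_mem hd)) hy⟩

theorem IsEmbedding.isSubstructure_range {f : X → Y} (hf : IsEmbedding E f) :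
    IsSubstructure E (Set.range f) := by
  rw [← Set.image_univ]
  exact IsSubstructure.image hf fun _ _ _ _ _ => trivial

/-- The equalizer of two morphisms is a substructure. -/
theorem IsMorphism.isSubstructure_eq {f g : X → Y} (hf : IsMorphism E f) (hg : IsMorphism E g) :
    IsSubstructure E {x | f x = g x} := by
  intro o xs x h hx
  have h1 := hf.map_op o xs x hx
  rw [show f ∘ xs = g ∘ xs from funext h] at h1
  exact Part.mem_unique h1 (hg.map_op o xs x hx)

theorem isMorphism_pi {S : Type*} {f : X → S → Y} (h : ∀ s, IsMorphism E fun x => f x s) :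
    IsMorphism E f :=
  ⟨fun o xs x hx => (mem_op_pi E o _ _).2 fun s => (h s).map_op o xs x hx,
    fun r xs hx s => (h s).map_rel r xs hx⟩

theorem isMorphism_eval {S : Type*} (s : S) : IsMorphism E fun x : S → X => x s :=
  ⟨fun o xs x hx => (mem_op_pi E o xs x).1 hx s, fun _ _ h => h s⟩

/-- Morphisms from the two parts of a direct union to `M̃` can be glued. -/
theorem IsDirectUnion.exists_extension {Z W : Type*} [Str E Z] [Str E W] {i : X → Z} {j : Y → Z}
    (h : IsDirectUnion (E := E) i j) {f : X → W} {g : Y → W} (hf : IsMorphism E f)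
    (hg : IsMorphism E g) : ∃ k : Z → W, IsMorphism E k ∧ k ∘ i = f ∧ k ∘ j = g := by
  have key : ∀ x y, i x = j y → f x = g y := by
    intro x y hxy
    -- The two parts overlap only in constants, and these lie in every substructure, so it suffices
    -- that the points of agreement form one.
    have hD : IsSubstructure E {x | ∃ y, i x = j y ∧ f x = g y} := by
      intro o xs x hxs hx
      choose ys h1 h2 using hxs
      have hi := h.left.map_op o xs x hx
      rw [show i ∘ xs = j ∘ ys from funext h1] at hi
      have hd := h.right.reflect_dom o ys hi.1
      refine ⟨_, Part.mem_unique hi (h.right.map_op o ys _ (Part.get_mem hd)), ?_⟩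
      have hfx := hf.map_op o xs x hx
      rw [show f ∘ xs = g ∘ ys from funext h2] at hfx
      exact Part.mem_unique hfx (hg.map_op o ys _ (Part.get_mem hd))
    obtain ⟨y', h1, h2⟩ := (h.inter x y hxy).1 _ hD
    rw [h2, h.right.injective (hxy.symm.trans h1)]
  have ex : ∀ z, ∃ w, (∀ x, i x = z → f x = w) ∧ (∀ y, j y = z → g y = w) := by
    intro z
    rcases h.cover z with ⟨x, rfl⟩ | ⟨y, rfl⟩
    · exact ⟨f x, fun x' hx => by rw [h.left.injective hx], fun y hy => (key x y hy.symm).symm⟩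
    · exact ⟨g y, fun x hx => key x y hx, fun y' hy => by rw [h.right.injective hy]⟩
  choose k hki hkj using ex
  have hi : k ∘ i = f := funext fun x => (hki _ x rfl).symm
  have hj : k ∘ j = g := funext fun y => (hkj _ y rfl).symm
  refine ⟨k, ⟨fun o zs z hz => ?_, fun r zs hz => ?_⟩, hi, hj⟩
  · rcases h.op_cases o zs z hz with ⟨xs, x, hx, rfl, rfl⟩ | ⟨xs, x, hx, rfl, rfl⟩
    · rw [← Function.comp_assoc, hi, ← hki _ x rfl]
      exact hf.map_op o xs x hx
    · rw [← Function.comp_assoc, hj, ← hkj _ x rfl]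
      exact hg.map_op o xs x hx
  · rcases h.rel_cases r zs hz with ⟨xs, hx, rfl⟩ | ⟨xs, hx, rfl⟩
    · rw [← Function.comp_assoc, hi]
      exact hf.map_rel r xs hx
    · rw [← Function.comp_assoc, hj]
      exact hg.map_rel r xs hx

end Str

variable (E : AlterEgo L M)

/-- The object of `𝒳` on a closed substructure. -/
def TopStr.ofClosed {E : AlterEgo L M} [TopologicalSpace M] (X : TopStr E) {D : Set X}
    (hD : Str.IsSubstructure E D) (hc : IsClosed D) : TopStr E :=
  letI := Str.sub hD
  { carrier := D
    mem := by
      obtain ⟨S, hS, e, he, he'⟩ := X.mem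
      exact ⟨S, hS, e ∘ Subtype.val, he.comp hc.isClosedEmbedding_subtypeVal,
        he'.comp (Str.isEmbedding_sub hD)⟩ }

/-! ### Duals of homomorphisms -/

section DualMap

variable {A B C : Type*} [L.Structure A] [L.Structure B] [L.Structure C]

/-- The first projection of a direct product, as a homomorphism. -/
def fstHom [L.IsAlgebraic] : A × B →[L] A where
  toFun := Prod.fst
  map_fun' _ _ := rfl
  map_rel' r := isEmptyElim r

/-- The second projection of a direct product, as a homomorphism. -/
def sndHom [L.IsAlgebraic] : A × B →[L] B where
  toFun := Prod.snd
  map_fun' _ _ := rfl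
  map_rel' r := isEmptyElim r

/-- The homomorphism into a direct product with the given components. -/
def prodHom [L.IsAlgebraic] (f : C →[L] A) (g : C →[L] B) : C →[L] A × B where
  toFun c := (f c, g c)
  map_fun' _ _ := Prod.ext (f.map_fun _ _) (g.map_fun _ _)
  map_rel' r := isEmptyElim r

section

variable [TopologicalSpace M]

theorem continuous_precomp (h : A →[L] B) :
    Continuous (fun φ : B →[L] M => φ.comp h) :=
  continuous_induced_rng.2 (continuous_pi fun a =>
    (continuous_apply (h a)).comp continuous_induced_dom)

end

variable [L.IsAlgebraic]

/-- Composition with a homomorphism `h` preserves the structure of the duals. -/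
theorem isMorphism_precomp (h : A →[L] B) :
    Str.IsMorphism E (fun φ : B →[L] M => φ.comp h) :=
  ⟨fun o _ _ hφ => (mem_op_hom E o _ _).2 fun a => (mem_op_hom E o _ _).1 hφ (h a),
    fun _ _ hφ a => hφ (h a)⟩

theorem isMorphism_homEval (a : A) : Str.IsMorphism E (fun φ : A →[L] M => φ a) :=
  ⟨fun o φs φ h => (mem_op_hom E o φs φ).1 h a, fun _ _ h => h a⟩

variable [TopologicalSpace M] [DiscreteTopology M]

instance : T2Space (A →[L] M) := (hom_isClosedEmbedding A).isEmbedding.t2Space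

instance [Finite M] : CompactSpace (A →[L] M) := (hom_isClosedEmbedding A).compactSpace

instance [Finite A] [Finite M] : Finite (A →[L] M) := DFunLike.finite _

end DualMap

section

variable [L.IsAlgebraic] [TopologicalSpace M] [DiscreteTopology M]

/-- The arrow of `𝒳` dual to a homomorphism. -/
def dualMap {A B : Type u} [L.Structure A] [L.Structure B] [Nonempty A] [Nonempty B]
    (h : A →[L] B) : dual E B ⟶ dual E A where
  toFun φ := (show B →[L] M from φ).comp h
  isMorphism := isMorphism_precomp E h
  continuous := continuous_precomp h

end

/-! ### Closure properties of `ISP(M)` -/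

section ISP

theorem MemISP.prod {A B : Type u} [L.Structure A] [L.Structure B] [L.IsAlgebraic]
    (hA : MemISP L M A) (hB : MemISP L M B) : MemISP L M (A × B) := by
  obtain ⟨⟨a⟩, S, ⟨f⟩⟩ := hA
  obtain ⟨⟨b⟩, T, ⟨g⟩⟩ := hB
  refine ⟨⟨(a, b)⟩, S ⊕ T, ⟨?_⟩⟩
  exact
    { toFun := fun x => Sum.elim (f x.1) (g x.2)
      inj' := fun x y h => Prod.ext
        (f.injective (funext fun s => congrFun h (Sum.inl s)))
        (g.injective (funext fun s => congrFun h (Sum.inr s)))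
      map_fun' := by
        intro n F x
        funext s
        rcases s with s | s
        · exact congrFun (f.map_fun F fun i => (x i).1) s
        · exact congrFun (g.map_fun F fun i => (x i).2) s
      map_rel' := fun r => isEmptyElim r }

theorem MemISP.substructure {S : Type u} (C : L.Substructure (S → M)) [hC : Nonempty C] :
    MemISP L M C :=
  ⟨hC, S, ⟨C.subtype⟩⟩

end ISP

/-! ### Natural extensions -/

section NatExt

variable [TopologicalSpace M] [DiscreteTopology M] {A : Type u} [L.Structure A]

theorem continuous_natExt_apply (φ : A →[L] M) : Continuous fun x : natExt L M A => x.1 φ :=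
  (continuous_apply φ).comp continuous_subtype_val

variable [L.IsAlgebraic]

variable (L M A) in
/-- The embedding of `A` into its natural extension. -/
def natExtEval : A →[L] natExt L M A where
  toFun a := ⟨fun φ => φ a, subset_closure ⟨a, rfl⟩⟩
  map_fun' f x := Subtype.ext (funext fun φ : A →[L] M => φ.map_fun f x)
  map_rel' r := isEmptyElim r

variable (L M A) in
theorem denseRange_natExtEval : DenseRange (natExtEval L M A) := by
  intro x
  rw [closure_subtype, ← Set.range_comp]
  exact x.2

instance [Finite M] : CompactSpace (natExt L M A) :=
  isCompact_iff_compactSpace.1 (isClosed_closure (X := (A →[L] M) → M)).isCompact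

instance [Nonempty A] : Nonempty (natExt L M A) := Nonempty.map (natExtEval L M A) inferInstance

/-- The restriction of `A` to a set of homomorphisms to `M`. -/
def restrictHom (F : Set (A →[L] M)) : A →[L] (F → M) where
  toFun a φ := φ.1 a
  map_fun' f x := funext fun φ => φ.1.map_fun f x
  map_rel' r := isEmptyElim r

instance [Nonempty A] (F : Set (A →[L] M)) : Nonempty (restrictHom F).range :=
  Nonempty.map (fun a => ⟨restrictHom F a, a, rfl⟩) ‹Nonempty A›

/-- The homomorphism from `A` onto its image under a set of homomorphisms to `M`. -/
def restrictRange (F : Set (A →[L] M)) : A →[L] (restrictHom F).range :=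
  (restrictHom F).codRestrict _ fun a => ⟨a, rfl⟩

/-- The extension to `A^δ` of the homomorphism `restrictRange F`, for a finite set `F`. -/
def natExtRestrict (F : Set (A →[L] M)) [Finite F] : natExt L M A →[L] (restrictHom F).range where
  toFun x := ⟨fun φ => x.1 φ.1, by
    have hc : Continuous fun y : (A →[L] M) → M => fun φ : F => y φ.1 :=
      continuous_pi fun φ => continuous_apply _
    have := map_mem_closure (t := ((restrictHom F).range : Set (F → M))) hc x.2
      (by rintro _ ⟨a, rfl⟩; exact ⟨a, rfl⟩)
    rwa [(isClosed_discrete _).closure_eq] at this⟩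
  map_fun' _ _ := rfl
  map_rel' r := isEmptyElim r

theorem natExtRestrict_surjective (F : Set (A →[L] M)) [Finite F] :
    Function.Surjective (natExtRestrict F) := by
  rintro ⟨_, a, rfl⟩
  exact ⟨natExtEval L M A a, rfl⟩

theorem continuous_natExtRestrict (F : Set (A →[L] M)) [Finite F] :
    Continuous (natExtRestrict F) :=
  continuous_induced_rng.2 (continuous_pi fun φ : F => continuous_natExt_apply φ.1)

variable {E : AlterEgo L M} [Finite M]

/-- The natural extension consists of the (not necessarily continuous) structure preserving maps. -/
theorem mem_natExt_iff [Nonempty A] (hfull : YieldsFullDuality E) {x : (A →[L] M) → M} :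
    x ∈ natExt L M A ↔ Str.IsMorphism E x := by
  constructor
  · intro hx
    -- A condition read off from a continuous map to a discrete space is closed, so it passes from
    -- the evaluations to their closure. Each preservation condition has this form, as arities are
    -- finite.
    have key : ∀ {κ : Type u} [TopologicalSpace κ] [DiscreteTopology κ]
        (f : ((A →[L] M) → M) → κ) (_ : Continuous f) (P : Set κ),
        (∀ a : A, f (fun φ => φ a) ∈ P) → f x ∈ P := by
      intro κ _ _ f hf P h
      have := map_mem_closure (t := P) hf hx (by rintro _ ⟨a, rfl⟩; exact h a)
      rwa [(isClosed_discrete _).closure_eq] at this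
    exact ⟨fun o φs φ h => key (fun y => (y ∘ φs, y φ))
        ((continuous_pi fun i => continuous_apply _).prodMk (continuous_apply _))
        {p | p.2 ∈ Str.op (E := E) o p.1} ((mem_op_hom E o φs φ).1 h),
      fun r φs h => key (fun y => y ∘ φs) (continuous_pi fun i => continuous_apply _) _ h⟩
  · intro hx
    change x ∈ closure _
    rw [mem_closure_iff]
    intro U hU hxU
    obtain ⟨I, V, hV, hsub⟩ := isOpen_pi_iff.1 hU x hxU
    -- The image of `A` in the power of `M` indexed by the finite set `I` is finite, and so is its
    -- dual. The map `k` induced by `x` on that dual is therefore continuous, and the duality makes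
    -- it evaluation at an element of `C`, which lifts to `A`.
    let C := (restrictHom (I : Set (A →[L] M))).range
    let q : A →[L] C := restrictRange (I : Set (A →[L] M))
    have hfinC : Finite C := inferInstance
    let k : (C →[L] M) → M := fun ψ => x (ψ.comp q)
    have hk : k ∈ (dual E C).dual := by
      refine ⟨hx.comp E (isMorphism_precomp E q), ?_⟩
      have : DiscreteTopology (C →[L] M) := inferInstance
      exact continuous_of_discreteTopology (α := C →[L] M)
    obtain ⟨c, hc⟩ := (hfull.eval_bijective C (MemISP.substructure C)).2 ⟨k, hk⟩
    obtain ⟨a, ha⟩ := c.2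
    refine ⟨_, hsub fun φ hφ => ?_, a, rfl⟩
    let pr : C →[L] M :=
      { toFun := fun c => c.1 ⟨φ, hφ⟩
        map_fun' := fun _ _ => rfl
        map_rel' := fun r => isEmptyElim r }
    have h1 : pr c = k pr := congrFun (congrArg Subtype.val hc) pr
    have h2 : k pr = x φ := rfl
    have h3 : pr c = φ a := (congrFun ha ⟨φ, hφ⟩).symm
    change φ a ∈ V φ
    rw [← h3, h1, h2]
    exact (hV φ hφ).2

theorem natExt_isMorphism [Nonempty A] (hfull : YieldsFullDuality E) (x : natExt L M A) :
    Str.IsMorphism E x.1 := (mem_natExt_iff hfull).1 x.2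

/-- Both sides are continuous in `x` and agree on the dense image of `A`. -/
theorem apply_natExtRestrict (F : Set (A →[L] M)) [Finite F] (γ : (restrictHom F).range →[L] M)
    (x : natExt L M A) : γ (natExtRestrict F x) = x.1 (γ.comp (restrictRange F)) := by
  have h1 : Continuous fun x => γ (natExtRestrict F x) :=
    (continuous_of_discreteTopology (f := γ)).comp (continuous_natExtRestrict F)
  exact congrFun ((denseRange_natExtEval L M A).equalizer h1
    (continuous_natExt_apply (γ.comp (restrictRange F))) (funext fun a => rfl)) x

end NatExt

/-! ### Coproducts in `𝒳` -/

section Coproduct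

variable [TopologicalSpace M] {E : AlterEgo L M}

/-- The morphisms to `M̃` separate the points of an object of `𝒳`. -/
theorem TopStr.ext_of_dual [DiscreteTopology M] {X : TopStr E} {x y : X} (h : ∀ k ∈ X.dual, k x = k y) : x = y := by
  obtain ⟨S, -, e, hc, he⟩ := X.mem
  refine he.injective (funext fun s => h (fun x => e x s) ⟨?_, ?_⟩)
  · exact (Str.isMorphism_eval s).comp E he.toIsMorphism
  · exact (continuous_apply s).comp hc.continuous

variable [L.IsAlgebraic] [DiscreteTopology M]
variable {A B : Type u} [L.Structure A] [L.Structure B] [Nonempty A] [Nonempty B]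

/-- Under a full duality, an arrow `A^* ⟶ X` comes from a homomorphism `X_* → A`. -/
theorem exists_hom_of_arrow (hfull : YieldsFullDuality E) (hA : MemISP L M A) {X : TopStr E}
    (f : dual E A ⟶ X) :
    ∃ a : X.dual →[L] A, ∀ (k : X.dual) (φ : A →[L] M), φ (a k) = k.1 (f.toFun φ) := by
  have hbij := hfull.eval_bijective A hA
  have : ∀ k : X.dual, ∃ a : A, evalHom E A a = ⟨fun φ => k.1 (f.toFun φ),
      k.2.1.comp E f.isMorphism, k.2.2.comp f.continuous⟩ := fun k => hbij.2 _
  choose a ha using this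
  have ha' : ∀ (k : X.dual) (φ : A →[L] M), φ (a k) = k.1 (f.toFun φ) :=
    fun k φ => congrFun (congrArg Subtype.val (ha k)) φ
  refine ⟨⟨a, fun F ks => hbij.1 (Subtype.ext (funext fun φ : A →[L] M => ?_)),
    fun r => isEmptyElim r⟩, ha'⟩
  change φ (a _) = φ (Language.Structure.funMap F (a ∘ ks))
  rw [ha', φ.map_fun]
  change Language.Structure.funMap F (fun i => (ks i).1 (f.toFun φ)) = _
  congr 1
  funext i
  exact (ha' _ _).symm

/-- The arrows `f` and `g` are dual to homomorphisms from $X_*$ to `A` and `B`. Their pairing into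
`A × B`, dualized and followed by the inverse of $X\to(X_*)^*$, is the copairing. -/
theorem coproduct_exists_desc (hfull : YieldsFullDuality E) (hA : MemISP L M A)
    (hB : MemISP L M B) {X : TopStr E} (f : dual E A ⟶ X) (g : dual E B ⟶ X) :
    ∃ d : dual E (A × B) ⟶ X, dualMap E fstHom ≫ d = f ∧ dualMap E sndHom ≫ d = g := by
  obtain ⟨a, ha⟩ := exists_hom_of_arrow hfull hA f
  obtain ⟨b, hb⟩ := exists_hom_of_arrow hfull hB g
  have := hfull.eval_isIso X
  refine ⟨dualMap E (prodHom a b) ≫ inv X.eval, ?_, ?_⟩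
  · rw [← Category.assoc, IsIso.comp_inv_eq]
    exact TopStr.Hom.ext (funext fun φ => Language.Hom.ext fun k => ha k φ)
  · rw [← Category.assoc, IsIso.comp_inv_eq]
    exact TopStr.Hom.ext (funext fun φ => Language.Hom.ext fun k => hb k φ)

/-- An arrow from $(\mathbf A\times\mathbf B)^*$ to `X` is determined by a homomorphism
$X_*\to\mathbf A\times\mathbf B$, because $X_*$ separates the points of `X`; the homomorphism is
determined by its two components. -/
theorem coproduct_hom_ext (hfull : YieldsFullDuality E) (hA : MemISP L M A)
    (hB : MemISP L M B) {X : TopStr E} {d d' : dual E (A × B) ⟶ X}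
    (h1 : dualMap E fstHom ≫ d = dualMap E fstHom ≫ d')
    (h2 : dualMap E sndHom ≫ d = dualMap E sndHom ≫ d') : d = d' := by
  obtain ⟨c, hc⟩ := exists_hom_of_arrow hfull (hA.prod hB) d
  obtain ⟨c', hc'⟩ := exists_hom_of_arrow hfull (hA.prod hB) d'
  have e1 (φ : A →[L] M) : d.toFun (φ.comp fstHom) = d'.toFun (φ.comp fstHom) :=
    congrFun (congrArg TopStr.Hom.toFun h1) φ
  have e2 (φ : B →[L] M) : d.toFun (φ.comp sndHom) = d'.toFun (φ.comp sndHom) :=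
    congrFun (congrArg TopStr.Hom.toFun h2) φ
  have hcc : c = c' := by
    refine Language.Hom.ext fun k => Prod.ext ?_ ?_
    · refine (hfull.eval_bijective A hA).1 (Subtype.ext (funext fun φ : A →[L] M => ?_))
      exact (hc k (φ.comp fstHom)).trans ((congrArg k.1 (e1 φ)).trans (hc' k (φ.comp fstHom)).symm)
    · refine (hfull.eval_bijective B hB).1 (Subtype.ext (funext fun φ : B →[L] M => ?_))
      exact (hc k (φ.comp sndHom)).trans ((congrArg k.1 (e2 φ)).trans (hc' k (φ.comp sndHom)).symm)
  subst hcc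
  refine TopStr.Hom.ext (funext fun w => TopStr.ext_of_dual fun k hk => ?_)
  exact (hc ⟨k, hk⟩ w).symm.trans (hc' ⟨k, hk⟩ w)

variable (E A B) in
/-- The cofan with vertex `(A × B)^*`. -/
abbrev dualCofan : BinaryCofan (dual E A) (dual E B) :=
  BinaryCofan.mk (dualMap E (fstHom : A × B →[L] A)) (dualMap E (sndHom : A × B →[L] B))

/-- Under a full duality, `(A × B)^*` is the coproduct of `A^*` and `B^*` in `𝒳`. -/
theorem nonempty_isColimit_dualCofan (hfull : YieldsFullDuality E) (hA : MemISP L M A)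
    (hB : MemISP L M B) : Nonempty (IsColimit (dualCofan E A B)) := by
  choose d h1 h2 using fun X : TopStr E =>
    coproduct_exists_desc (X := X) hfull hA hB
  exact ⟨BinaryCofan.IsColimit.mk _ (fun f g => d _ f g) (fun f g => h1 _ f g)
    (fun f g => h2 _ f g) fun f g m hm1 hm2 =>
      coproduct_hom_ext hfull hA hB (hm1.trans (h1 _ f g).symm) (hm2.trans (h2 _ f g).symm)⟩

/-- A closed substructure of `(A × B)^*` that contains the images of `A^*` and `B^*` is everything. -/
theorem mem_of_isClosed_substructure (hfull : YieldsFullDuality E) (hA : MemISP L M A)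
    (hB : MemISP L M B) {T : Set (A × B →[L] M)} (hT : Str.IsSubstructure E T) (hc : IsClosed T)
    (h1 : ∀ φ : A →[L] M, φ.comp fstHom ∈ T) (h2 : ∀ φ : B →[L] M, φ.comp sndHom ∈ T)
    (w : A × B →[L] M) : w ∈ T := by
  let := Str.sub hT
  let Y : TopStr E := TopStr.ofClosed (dual E (A × B)) hT hc
  let ι : Y ⟶ dual E (A × B) :=
    ⟨Subtype.val, (Str.isEmbedding_sub hT).toIsMorphism, continuous_subtype_val⟩
  let f : dual E A ⟶ Y := ⟨fun φ => ⟨_, h1 φ⟩,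
    (Str.isEmbedding_sub hT).of_comp (isMorphism_precomp E fstHom),
    (continuous_precomp fstHom).subtype_mk _⟩
  let g : dual E B ⟶ Y := ⟨fun φ => ⟨_, h2 φ⟩,
    (Str.isEmbedding_sub hT).of_comp (isMorphism_precomp E sndHom),
    (continuous_precomp sndHom).subtype_mk _⟩
  obtain ⟨d, hd1, hd2⟩ := coproduct_exists_desc hfull hA hB f g
  -- The copairing into `T` followed by the inclusion agrees with the identity on both
  -- coprojections, so every `w` is a value of the inclusion.
  have : d ≫ ι = 𝟙 _ := by
    refine coproduct_hom_ext hfull hA hB ?_ ?_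
    · rw [← Category.assoc, hd1, Category.comp_id]
      rfl
    · rw [← Category.assoc, hd2, Category.comp_id]
      rfl
  have hw : (d.toFun w).1 = w := congrFun (congrArg TopStr.Hom.toFun this) w
  exact hw ▸ (d.toFun w).2

end Coproduct

/-! ### Continuous homomorphisms to `M` -/

section ContHom

variable [L.IsAlgebraic] [TopologicalSpace M] [DiscreteTopology M] (E : AlterEgo L M)

/-- The finitely many continuous arguments are jointly locally constant because `M` is discrete;
operations act pointwise, so the result is locally constant too. -/
theorem isSubstructure_continuous (P : Type*) [L.Structure P] [TopologicalSpace P] :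
    Str.IsSubstructure E {u : P →[L] M | Continuous u} := by
  intro o us u hus hu
  have hc : Continuous fun p i => us i p := continuous_pi hus
  refine continuous_iff_continuousAt.2 fun p => ?_
  have h : ∀ᶠ q in nhds p, (fun i => us i q) = fun i => us i p :=
    ((isOpen_discrete {fun i => us i p}).preimage hc).mem_nhds rfl
  refine (continuousAt_const (y := u p)).congr (h.mono fun q hq => ?_)
  have h1 := (mem_op_hom E o us u).1 hu q
  rw [hq] at h1
  exact Part.mem_unique ((mem_op_hom E o us u).1 hu p) h1

/-- The structure of the continuous homomorphisms to `M`, as an object of `ISP(M̃^♭)`. -/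
def contDual (P : Type u) [L.Structure P] [TopologicalSpace P] [Nonempty P] : FlatStr E :=
  letI := Str.sub (isSubstructure_continuous E P)
  { carrier := {u : P →[L] M | Continuous u}
    mem := ⟨P, inferInstance, _, (hom_isEmbedding E P).comp (Str.isEmbedding_sub _)⟩ }

/-- The inclusion of the continuous homomorphisms in all homomorphisms. -/
theorem contDual_isEmbedding (P : Type u) [L.Structure P] [TopologicalSpace P] [Nonempty P] :
    Str.IsEmbedding E (fun u : contDual E P => (u.1 : P →[L] M)) :=
  Str.isEmbedding_sub (isSubstructure_continuous E P)

omit [TopologicalSpace M] [DiscreteTopology M] in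
/-- A homomorphism that is constant on the fibres of a surjective one factors through it. -/
theorem exists_comp_eq_of_surjective {P Q : Type*} [L.Structure P] [L.Structure Q] {ρ : P →[L] Q}
    (hρ : Function.Surjective ρ) {u : P →[L] M} (h : ∀ p p', ρ p = ρ p' → u p = u p') :
    ∃ u' : Q →[L] M, u'.comp ρ = u := by
  choose t ht using hρ
  refine ⟨⟨fun q => u (t q), fun F qs => ?_, fun r => isEmptyElim r⟩,
    Language.Hom.ext fun p => h _ _ (ht _)⟩
  refine Eq.trans (h _ (Language.Structure.funMap F (t ∘ qs)) ?_) (u.map_fun F _)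
  rw [ht, ρ.map_fun]
  congr 1
  exact funext fun i => (ht _).symm

end ContHom

/-! ### Generation of the continuous homomorphisms on `A^δ × B^δ` by evaluations -/

section Generation

variable [TopologicalSpace M] [DiscreteTopology M]
variable {A B : Type u} [L.Structure A] [L.Structure B]

/-- A continuous map from `A^δ × B^δ` to `M` depends on finitely many coordinates only. -/
theorem exists_finite_coordinates [Finite M] {u : natExt L M A × natExt L M B → M}
    (hu : Continuous u) :
    ∃ (F : Set (A →[L] M)) (G : Set (B →[L] M)), F.Finite ∧ G.Finite ∧ ∀ p p',
      (∀ φ ∈ F, p.1.1 φ = p'.1.1 φ) → (∀ ψ ∈ G, p.2.1 ψ = p'.2.1 ψ) → u p = u p' := by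
  suffices h : ∃ (F : Set (A →[L] M)) (G : Set (B →[L] M)), F.Finite ∧ G.Finite ∧
      ∀ p ∈ Set.univ, ∀ p', (∀ φ ∈ F, p.1.1 φ = p'.1.1 φ) → (∀ ψ ∈ G, p.2.1 ψ = p'.2.1 ψ) →
        u p = u p' by simpa using h
  -- Only `p` is confined to `s`, while `p'` is arbitrary; this makes the property stable under
  -- unions, so by compactness it is enough to verify it locally.
  refine isCompact_univ.induction_on (p := fun s => ∃ (F : Set (A →[L] M)) (G : Set (B →[L] M)),
      F.Finite ∧ G.Finite ∧ ∀ p ∈ s, ∀ p', (∀ φ ∈ F, p.1.1 φ = p'.1.1 φ) →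
        (∀ ψ ∈ G, p.2.1 ψ = p'.2.1 ψ) → u p = u p') ?_ ?_ ?_ ?_
  · exact ⟨∅, ∅, Set.finite_empty, Set.finite_empty, fun p hp => hp.elim⟩
  · rintro s t hst ⟨F, G, hF, hG, h⟩
    exact ⟨F, G, hF, hG, fun p hp => h p (hst hp)⟩
  · rintro s t ⟨F, G, hF, hG, h⟩ ⟨F', G', hF', hG', h'⟩
    refine ⟨F ∪ F', G ∪ G', hF.union hF', hG.union hG', fun p hp p' h1 h2 => ?_⟩
    rcases hp with hp | hp
    · exact h p hp p' (fun φ hφ => h1 φ (Or.inl hφ)) fun ψ hψ => h2 ψ (Or.inl hψ)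
    · exact h' p hp p' (fun φ hφ => h1 φ (Or.inr hφ)) fun ψ hψ => h2 ψ (Or.inr hψ)
  · rintro p₀ -
    have hind : Topology.IsInducing (Prod.map Subtype.val Subtype.val :
        natExt L M A × natExt L M B → ((A →[L] M) → M) × ((B →[L] M) → M)) :=
      Topology.IsInducing.subtypeVal.prodMap Topology.IsInducing.subtypeVal
    obtain ⟨V, hV, hVu⟩ := hind.isOpen_iff.1 ((isOpen_discrete {u p₀}).preimage hu)
    have hp₀ : (p₀.1.1, p₀.2.1) ∈ V := by
      have : p₀ ∈ u ⁻¹' {u p₀} := rfl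
      rwa [← hVu] at this
    obtain ⟨V₁, V₂, hV₁, hV₂, h₁, h₂, hsub⟩ := isOpen_prod_iff.1 hV _ _ hp₀
    obtain ⟨F, a, ha, hF⟩ := isOpen_pi_iff.1 hV₁ _ h₁
    obtain ⟨G, b, hb, hG⟩ := isOpen_pi_iff.1 hV₂ _ h₂
    have key : ∀ p : natExt L M A × natExt L M B, (∀ φ ∈ F, p₀.1.1 φ = p.1.1 φ) →
        (∀ ψ ∈ G, p₀.2.1 ψ = p.2.1 ψ) → u p = u p₀ := by
      intro p h1 h2
      have : p ∈ Prod.map Subtype.val Subtype.val ⁻¹' V :=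
        hsub ⟨hF fun φ hφ => (h1 φ hφ ▸ (ha φ hφ).2 : p.1.1 φ ∈ a φ),
          hG fun ψ hψ => (h2 ψ hψ ▸ (hb ψ hψ).2 : p.2.1 ψ ∈ b ψ)⟩
      rwa [hVu] at this
    -- On this cylinder around `p₀` the map `u` is constant, and any point sharing its coordinates
    -- in `F` and `G` with a point of the cylinder is again in it.
    refine ⟨{p | (∀ φ ∈ F, p₀.1.1 φ = p.1.1 φ) ∧ ∀ ψ ∈ G, p₀.2.1 ψ = p.2.1 ψ}, ?_,
      F, G, F.finite_toSet, G.finite_toSet, fun p hp p' h1 h2 => ?_⟩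
    · refine mem_nhdsWithin_of_mem_nhds (IsOpen.mem_nhds ?_ ⟨fun _ _ => rfl, fun _ _ => rfl⟩)
      have ho : IsOpen ((⋂ φ ∈ F, (fun p : natExt L M A × natExt L M B => p.1.1 φ) ⁻¹'
          {m | p₀.1.1 φ = m}) ∩ ⋂ ψ ∈ G, (fun p : natExt L M A × natExt L M B => p.2.1 ψ) ⁻¹'
          {m | p₀.2.1 ψ = m}) :=
        (isOpen_biInter_finset fun φ _ => (isOpen_discrete _).preimage
          ((continuous_natExt_apply φ).comp continuous_fst)).inter
        (isOpen_biInter_finset fun ψ _ => (isOpen_discrete _).preimage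
          ((continuous_natExt_apply ψ).comp continuous_snd))
      convert ho using 1
      ext p
      simp [eq_comm]
    · rw [key p hp.1 hp.2, key p' (fun φ hφ => (hp.1 φ hφ).trans (h1 φ hφ))
        fun ψ hψ => (hp.2 ψ hψ).trans (h2 ψ hψ)]

variable [L.IsAlgebraic]

variable (B) in
/-- Evaluation at `φ ∈ A^*`, on `A^δ × B^δ`. -/
def fstEval (φ : A →[L] M) : natExt L M A × natExt L M B →[L] M where
  toFun p := p.1.1 φ
  map_fun' _ _ := rfl
  map_rel' r := isEmptyElim r

variable (A) in
/-- Evaluation at `ψ ∈ B^*`, on `A^δ × B^δ`. -/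
def sndEval (ψ : B →[L] M) : natExt L M A × natExt L M B →[L] M where
  toFun p := p.2.1 ψ
  map_fun' _ _ := rfl
  map_rel' r := isEmptyElim r

theorem continuous_fstEval (φ : A →[L] M) : Continuous (fstEval B φ) :=
  (continuous_natExt_apply φ).comp continuous_fst

theorem continuous_sndEval (ψ : B →[L] M) : Continuous (sndEval A ψ) :=
  (continuous_natExt_apply ψ).comp continuous_snd

variable {E : AlterEgo L M} [Finite M]

theorem isMorphism_fstEval [Nonempty A] (hfull : YieldsFullDuality E) :
    Str.IsMorphism E (fstEval B : (A →[L] M) → _) :=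
  ⟨fun o φs φ h => (mem_op_hom E o _ _).2 fun p =>
      (natExt_isMorphism hfull p.1).map_op o φs φ h,
    fun r φs h p => (natExt_isMorphism hfull p.1).map_rel r φs h⟩

theorem isMorphism_sndEval [Nonempty B] (hfull : YieldsFullDuality E) :
    Str.IsMorphism E (sndEval A : (B →[L] M) → _) :=
  ⟨fun o φs φ h => (mem_op_hom E o _ _).2 fun p =>
      (natExt_isMorphism hfull p.2).map_op o φs φ h,
    fun r φs h p => (natExt_isMorphism hfull p.2).map_rel r φs h⟩

/-- The continuous homomorphisms from `A^δ × B^δ` to `M` are generated by the evaluations. -/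
theorem mem_of_isSubstructure_of_continuous [Nonempty A] [Nonempty B] (hfull : YieldsFullDuality E)
    {W : Set (natExt L M A × natExt L M B →[L] M)} (hW : Str.IsSubstructure E W)
    (h1 : ∀ φ, fstEval B φ ∈ W) (h2 : ∀ ψ, sndEval A ψ ∈ W)
    {u : natExt L M A × natExt L M B →[L] M} (hu : Continuous u) : u ∈ W := by
  obtain ⟨F, G, hF, hG, h⟩ := exists_finite_coordinates hu
  have := hF.to_subtype
  have := hG.to_subtype
  -- The coordinates in `F` and `G` determine `u`, so `u` factors through this homomorphism onto a
  -- product of two finite algebras.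
  let ρ : natExt L M A × natExt L M B →[L] (restrictHom F).range × (restrictHom G).range :=
    prodHom ((natExtRestrict F).comp fstHom) ((natExtRestrict G).comp sndHom)
  have hρ : Function.Surjective ρ := by
    rintro ⟨c, d⟩
    obtain ⟨x, rfl⟩ := natExtRestrict_surjective F c
    obtain ⟨y, rfl⟩ := natExtRestrict_surjective G d
    exact ⟨(x, y), rfl⟩
  obtain ⟨u', rfl⟩ := exists_comp_eq_of_surjective hρ (u := u) fun p p' hp => by
    obtain ⟨hp1, hp2⟩ := Prod.ext_iff.1 hp
    exact h p p' (fun φ hφ => congrFun (congrArg Subtype.val hp1) ⟨φ, hφ⟩)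
      fun ψ hψ => congrFun (congrArg Subtype.val hp2) ⟨ψ, hψ⟩
  -- The dual of the finite product is finite, so the preimage of `W` in it is closed. It contains
  -- the duals of both factors, since their elements pull back along `ρ` to evaluations.
  refine mem_of_isClosed_substructure hfull (MemISP.substructure _) (MemISP.substructure _)
    (hW.preimage (isMorphism_precomp E ρ)) (Set.toFinite _).isClosed (fun γ => ?_) (fun γ => ?_) u'
  · have : (γ.comp fstHom).comp ρ = fstEval B (γ.comp (restrictRange F)) :=
      Language.Hom.ext fun p => apply_natExtRestrict F γ p.1
    exact (this ▸ h1 _ : (γ.comp fstHom).comp ρ ∈ W)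
  · have : (γ.comp sndHom).comp ρ = sndEval A (γ.comp (restrictRange G)) :=
      Language.Hom.ext fun p => apply_natExtRestrict G γ p.2
    exact (this ▸ h2 _ : (γ.comp sndHom).comp ρ ∈ W)

end Generation

/-! ### Coproducts in `ISP(M̃^♭)` -/

section FlatCoproduct

variable [TopologicalSpace M] [DiscreteTopology M] [Finite M] [L.IsAlgebraic]
variable {A B : Type u} [L.Structure A] [L.Structure B] [Nonempty A] [Nonempty B]
variable {E : AlterEgo L M}

variable (A B) in
/-- The cofan in `ISP(M̃^♭)` with vertex the continuous homomorphisms `A^δ × B^δ → M`. -/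
def contDualCofan (hfull : YieldsFullDuality E) :
    BinaryCofan (flat.obj (dual E A)) (flat.obj (dual E B)) :=
  BinaryCofan.mk (P := contDual E (natExt L M A × natExt L M B))
    ⟨fun φ : A →[L] M => ⟨fstEval B φ, continuous_fstEval φ⟩,
      (contDual_isEmbedding E _).of_comp (isMorphism_fstEval hfull)⟩
    ⟨fun ψ : B →[L] M => ⟨sndEval A ψ, continuous_sndEval ψ⟩,
      (contDual_isEmbedding E _).of_comp (isMorphism_sndEval hfull)⟩

theorem mem_of_isSubstructure_contDual (hfull : YieldsFullDuality E)
    {W : Set (contDual E (natExt L M A × natExt L M B))} (hW : Str.IsSubstructure E W)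
    (h1 : ∀ φ : A →[L] M, (⟨fstEval B φ, continuous_fstEval φ⟩ : contDual E _) ∈ W)
    (h2 : ∀ ψ : B →[L] M, (⟨sndEval A ψ, continuous_sndEval ψ⟩ : contDual E _) ∈ W)
    (u : contDual E (natExt L M A × natExt L M B)) : u ∈ W := by
  obtain ⟨u', hu', h⟩ := mem_of_isSubstructure_of_continuous hfull
    (Str.IsSubstructure.image (contDual_isEmbedding E _) hW) (fun φ => ⟨_, h1 φ, rfl⟩)
    (fun ψ => ⟨_, h2 ψ, rfl⟩) u.2
  exact Subtype.ext h ▸ hu'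

/-- With `Z` embedded in a power of $\utilde M^\flat$, the coordinates of `f` and `g` at `s` are
points of $\mathbf A^\delta$ and $\mathbf B^\delta$. Evaluation at this pair is the coordinate of
the copairing; the values stay in `Z` because the evaluations generate. -/
theorem contDual_exists_desc (hfull : YieldsFullDuality E) {Z : FlatStr E}
    (f : flat.obj (dual E A) ⟶ Z) (g : flat.obj (dual E B) ⟶ Z) :
    ∃ d : contDual E (natExt L M A × natExt L M B) ⟶ Z,
      (contDualCofan A B hfull).inl ≫ d = f ∧ (contDualCofan A B hfull).inr ≫ d = g := by
  obtain ⟨S, -, e, he⟩ := Z.mem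
  let x (s : S) : natExt L M A := ⟨fun φ => e (f.toFun φ) s, (mem_natExt_iff hfull).2
    (((Str.isMorphism_eval s).comp E he.toIsMorphism).comp E f.isMorphism)⟩
  let y (s : S) : natExt L M B := ⟨fun ψ => e (g.toFun ψ) s, (mem_natExt_iff hfull).2
    (((Str.isMorphism_eval s).comp E he.toIsMorphism).comp E g.isMorphism)⟩
  let k : contDual E (natExt L M A × natExt L M B) → S → M := fun u s => u.1 (x s, y s)
  have hk : Str.IsMorphism E k := Str.isMorphism_pi fun s =>
    (isMorphism_homEval E (x s, y s)).comp E (contDual_isEmbedding E _).toIsMorphism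
  have hrange (u) : k u ∈ Set.range e := mem_of_isSubstructure_contDual hfull
    (he.isSubstructure_range.preimage hk) (fun φ => ⟨f.toFun φ, rfl⟩) (fun ψ => ⟨g.toFun ψ, rfl⟩) u
  choose d hd using hrange
  refine ⟨⟨d, he.of_comp ((funext hd : e ∘ d = k) ▸ hk)⟩, ?_, ?_⟩
  · exact FlatStr.Hom.ext (funext fun φ => he.injective (hd _))
  · exact FlatStr.Hom.ext (funext fun φ => he.injective (hd _))

theorem contDual_hom_ext (hfull : YieldsFullDuality E) {Z : FlatStr E}
    {d d' : contDual E (natExt L M A × natExt L M B) ⟶ Z}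
    (h1 : (contDualCofan A B hfull).inl ≫ d = (contDualCofan A B hfull).inl ≫ d')
    (h2 : (contDualCofan A B hfull).inr ≫ d = (contDualCofan A B hfull).inr ≫ d') : d = d' :=
  FlatStr.Hom.ext (funext fun u => mem_of_isSubstructure_contDual hfull
    (d.isMorphism.isSubstructure_eq d'.isMorphism)
    (fun φ => congrFun (congrArg FlatStr.Hom.toFun h1) φ)
    (fun φ => congrFun (congrArg FlatStr.Hom.toFun h2) φ) u)

/-- The continuous homomorphisms `A^δ × B^δ → M` form the coproduct of `(A^*)^♭` and `(B^*)^♭`. -/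
theorem nonempty_isColimit_contDualCofan (hfull : YieldsFullDuality E) :
    Nonempty (IsColimit (contDualCofan A B hfull)) := by
  choose d h1 h2 using fun Z : FlatStr E =>
    contDual_exists_desc (A := A) (B := B) (Z := Z) hfull
  exact ⟨BinaryCofan.IsColimit.mk _ (fun f g => d _ f g) (fun f g => h1 _ f g)
    (fun f g => h2 _ f g) fun f g m hm1 hm2 =>
      contDual_hom_ext hfull (hm1.trans (h1 _ f g).symm) (hm2.trans (h2 _ f g).symm)⟩

end FlatCoproduct

/-! ### Equivalence of the two isomorphism conditions -/

section Main

/-- A continuous bijective homomorphism from a compact to a Hausdorff algebra is an isomorphism of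
topological algebras. -/
theorem exists_equiv_of_bijective [L.IsAlgebraic] {P Q : Type*} [L.Structure P] [L.Structure Q]
    [TopologicalSpace P] [TopologicalSpace Q] [CompactSpace P] [T2Space Q] (h : P →[L] Q)
    (hc : Continuous h) (hb : Function.Bijective h) :
    ∃ Φ : P ≃[L] Q, (∀ p, Φ p = h p) ∧ IsHomeomorph Φ := by
  refine ⟨⟨Equiv.ofBijective h hb, fun F x => h.map_fun F x, fun r => isEmptyElim r⟩,
    fun _ => rfl, ?_⟩
  exact isHomeomorph_iff_continuous_bijective.2 ⟨hc, hb⟩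

variable [L.IsAlgebraic] [TopologicalSpace M] [DiscreteTopology M] [Finite M]
variable {E : AlterEgo L M}
variable {A B C : Type u} [L.Structure A] [L.Structure B] [L.Structure C]

section Pullback

variable [Nonempty A] [Nonempty C]

/-- The homomorphism `C^δ → A^δ` that is dual to a morphism from `(A^*)^♭` to `(C^*)^♭`. -/
def natExtPullback (hfull : YieldsFullDuality E) (α : (A →[L] M) → (C →[L] M))
    (hα : Str.IsMorphism E α) : natExt L M C →[L] natExt L M A where
  toFun x := ⟨fun φ => x.1 (α φ),
    (mem_natExt_iff hfull).2 ((natExt_isMorphism hfull x).comp E hα)⟩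
  map_fun' _ _ := rfl
  map_rel' r := isEmptyElim r

theorem continuous_natExtPullback (hfull : YieldsFullDuality E) (α : (A →[L] M) → (C →[L] M))
    (hα : Str.IsMorphism E α) : Continuous (natExtPullback hfull α hα) :=
  continuous_induced_rng.2 (continuous_pi fun φ : A →[L] M => continuous_natExt_apply (α φ))

variable [Nonempty B]

/-- If the morphisms to `M̃` on `(A^*)^♭` and `(B^*)^♭` extend uniquely to `(C^*)^♭`, then `C^δ` is
isomorphic to `A^δ × B^δ`. -/
theorem exists_equiv_of_existsUnique (hfull : YieldsFullDuality E)
    {α : (A →[L] M) → (C →[L] M)} (hα : Str.IsMorphism E α)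
    {β : (B →[L] M) → (C →[L] M)} (hβ : Str.IsMorphism E β)
    (hext : ∀ (f : (A →[L] M) → M) (g : (B →[L] M) → M), Str.IsMorphism E f →
      Str.IsMorphism E g → ∃ k : (C →[L] M) → M, Str.IsMorphism E k ∧ k ∘ α = f ∧ k ∘ β = g)
    (huniq : ∀ k k' : (C →[L] M) → M, Str.IsMorphism E k → Str.IsMorphism E k' →
      k ∘ α = k' ∘ α → k ∘ β = k' ∘ β → k = k') :
    ∃ Φ : natExt L M C ≃[L] natExt L M A × natExt L M B,
      (∀ x, Φ x = (natExtPullback hfull α hα x, natExtPullback hfull β hβ x)) ∧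
      IsHomeomorph Φ := by
  refine exists_equiv_of_bijective (prodHom (natExtPullback hfull α hα)
    (natExtPullback hfull β hβ)) ((continuous_natExtPullback hfull α hα).prodMk
      (continuous_natExtPullback hfull β hβ)) ⟨fun x x' h => ?_, fun ⟨y, z⟩ => ?_⟩
  · obtain ⟨h1, h2⟩ := Prod.ext_iff.1 h
    exact Subtype.ext (huniq _ _ (natExt_isMorphism hfull x) (natExt_isMorphism hfull x')
      (congrArg Subtype.val h1) (congrArg Subtype.val h2))
  · obtain ⟨k, hk, h1, h2⟩ := hext _ _ (natExt_isMorphism hfull y) (natExt_isMorphism hfull z)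
    exact ⟨⟨k, (mem_natExt_iff hfull).2 hk⟩, Prod.ext (Subtype.ext h1) (Subtype.ext h2)⟩

end Pullback

variable [Nonempty A] [Nonempty B]

/-- The topological algebras `(A × B)^δ` and `A^δ × B^δ` are isomorphic if and only if `((A × B)^*)^♭`
is isomorphic to the structure of continuous homomorphisms from `A^δ × B^δ` to `M`. -/
theorem exists_homeomorph_iff_nonempty_iso (hfull : YieldsFullDuality E) :
    (∃ Φ : natExt L M (A × B) ≃[L] natExt L M A × natExt L M B, IsHomeomorph Φ) ↔
      Nonempty (flat.obj (dual E (A × B)) ≅ contDual E (natExt L M A × natExt L M B)) := by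
  constructor
  · rintro ⟨Φ, hΦ⟩
    have hsymm : Continuous Φ.symm := (Equiv.toHomeomorphOfIsInducing Φ.toEquiv
      hΦ.isEmbedding.isInducing).symm.continuous
    -- Evaluation at `w` transported along the inverse of `Φ`. The inverse construction composes `u`
    -- with `Φ` and the embedding of `A × B`.
    let s (w : A × B →[L] M) : natExt L M A × natExt L M B →[L] M :=
      { toFun := fun y => (Φ.symm y).1 w
        map_fun' := fun F ys =>
          congrFun (congrArg Subtype.val (Φ.symm.map_fun F ys)) w
        map_rel' := fun r => isEmptyElim r }
    have hs (w) : Continuous (s w) := (continuous_natExt_apply w).comp hsymm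
    have hs' : Str.IsMorphism E s :=
      ⟨fun o ws w h => (mem_op_hom E o _ _).2 fun y =>
          (natExt_isMorphism hfull (Φ.symm y)).map_op o ws w h,
        fun r ws h y => (natExt_isMorphism hfull (Φ.symm y)).map_rel r ws h⟩
    let t : A × B →[L] natExt L M A × natExt L M B := Φ.toHom.comp (natExtEval L M (A × B))
    refine ⟨⟨⟨fun w => ⟨s w, hs w⟩, (contDual_isEmbedding E _).of_comp hs'⟩,
      ⟨fun u => (u.1.comp t : A × B →[L] M),
        (isMorphism_precomp E t).comp E (contDual_isEmbedding E _).toIsMorphism⟩,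
      FlatStr.Hom.ext (funext fun w => ?_), FlatStr.Hom.ext (funext fun u => ?_)⟩⟩
    · refine Language.Hom.ext fun c => ?_
      exact congrArg (fun x : natExt L M (A × B) => x.1 w)
        (Φ.symm_apply_apply (natExtEval L M (A × B) c))
    · refine Subtype.ext (Language.Hom.ext fun y => ?_)
      -- A continuous homomorphism on the natural extension is the evaluation at its own restriction
      -- to `A × B`, by density.
      have h := (denseRange_natExtEval L M (A × B)).equalizer
        (continuous_natExt_apply (u.1.comp t)) (u.2.comp hΦ.continuous) (funext fun c => rfl)
      exact (congrFun h (Φ.symm y)).trans (congrArg u.1 (Φ.apply_symm_apply y))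
  · rintro ⟨σ⟩
    -- Since `σ` is an arbitrary isomorphism, not assumed compatible with the coprojections, the
    -- coproduct maps are carried over along its inverse.
    let i := (contDualCofan A B hfull).inl ≫ σ.inv
    let j := (contDualCofan A B hfull).inr ≫ σ.inv
    have hσ (u) : σ.hom.toFun (σ.inv.toFun u) = u :=
      congrFun (congrArg FlatStr.Hom.toFun σ.inv_hom_id) u
    have hσ' (w) : σ.inv.toFun (σ.hom.toFun w) = w :=
      congrFun (congrArg FlatStr.Hom.toFun σ.hom_inv_id) w
    have hext (f : (A →[L] M) → M) (g : (B →[L] M) → M) (hf : Str.IsMorphism E f)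
        (hg : Str.IsMorphism E g) : ∃ k : (A × B →[L] M) → M,
        Str.IsMorphism E k ∧ k ∘ i.toFun = f ∧ k ∘ j.toFun = g := by
      let p : natExt L M A × natExt L M B :=
        (⟨f, (mem_natExt_iff hfull).2 hf⟩, ⟨g, (mem_natExt_iff hfull).2 hg⟩)
      refine ⟨fun w => (σ.hom.toFun w).1 p, ?_, funext fun φ => ?_, funext fun ψ => ?_⟩
      · exact ((isMorphism_homEval E p).comp E (contDual_isEmbedding E _).toIsMorphism).comp E
          σ.hom.isMorphism
      · exact congrArg (fun u => u.1 p) (hσ _)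
      · exact congrArg (fun u => u.1 p) (hσ _)
    have huniq (k k' : (A × B →[L] M) → M) (hk : Str.IsMorphism E k) (hk' : Str.IsMorphism E k')
        (h1 : k ∘ i.toFun = k' ∘ i.toFun) (h2 : k ∘ j.toFun = k' ∘ j.toFun) : k = k' := by
      refine funext fun w => ?_
      have := mem_of_isSubstructure_contDual hfull
        ((hk.comp E σ.inv.isMorphism).isSubstructure_eq (hk'.comp E σ.inv.isMorphism))
        (fun φ => congrFun h1 φ) (fun ψ => congrFun h2 ψ) (σ.hom.toFun w)
      exact (congrArg k (hσ' w)).symm.trans (this.trans (congrArg k' (hσ' w)))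
    obtain ⟨Φ, -, hΦ⟩ :=
      exists_equiv_of_existsUnique hfull i.isMorphism j.isMorphism hext huniq
    exact ⟨Φ, hΦ⟩

end Main

/-! ### The topologies `δ` -/

section Delta

variable [L.IsAlgebraic] [TopologicalSpace M] [DiscreteTopology M]
variable {E : AlterEgo L M}
variable {A B C : Type u} [L.Structure A] [L.Structure B] [L.Structure C]

/-- The set of the `y` that extend `f ∘ α` is open for the topology `δ`, if `O_f` is one of the basic
open sets. -/
theorem isOpen_extending_comp {α : (A →[L] M) → (C →[L] M)} (hα : Str.IsMorphism E α)
    (hαc : Continuous α) {D : Set (C →[L] M)} {f : D → M} (hD : IsClosed D)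
    (hDs : Str.IsSubstructure E D) (hf : Str.IsMorphismOn E D f) (hfc : Continuous f) :
    @IsOpen _ (deltaTopology E A) (extending (α ⁻¹' D) fun φ => f ⟨α φ, φ.2⟩) := by
  refine TopologicalSpace.isOpen_generateFrom_of_mem ⟨α ⁻¹' D, _, hD.preimage hαc,
    hDs.preimage hα, ⟨fun o φs φ h => ?_, fun r φs h => ?_⟩, ?_, rfl⟩
  · exact hf.map_op o (fun i => ⟨α (φs i), (φs i).2⟩) ⟨α φ, φ.2⟩ (hα.map_op o _ _ h)
  · exact hf.map_rel r (fun i => ⟨α (φs i), (φs i).2⟩) (hα.map_rel r _ h)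
  · exact hfc.comp ((hαc.comp continuous_subtype_val).subtype_mk _)

variable [Finite M]

/-- The preimage of a basic open set `O_f` for the topology `δ` under the homomorphism dual to an
embedding is open. -/
theorem isOpen_preimage_natExtPullback [Nonempty A] [Nonempty C] (hfull : YieldsFullDuality E)
    {α : (A →[L] M) → (C →[L] M)} (hα : Str.IsEmbedding E α) (hαc : Continuous α)
    {D : Set (A →[L] M)} {f : D → M} (hD : IsClosed D) (hDs : Str.IsSubstructure E D)
    (hf : Str.IsMorphismOn E D f) (hfc : Continuous f) :
    @IsOpen _ (deltaTopology E C) (natExtPullback hfull α hα.toIsMorphism ⁻¹' extending D f) := by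
  let e : D ≃ α '' D := Equiv.Set.image α D hα.injective
  have he : Continuous e := (hαc.comp continuous_subtype_val).subtype_mk _
  have : CompactSpace D := isCompact_iff_compactSpace.1 hD.isCompact
  have hval (w : α '' D) : α (e.symm w) = w := congrArg Subtype.val (e.apply_symm_apply w)
  -- The partial morphism `f` is moved to the image of its domain, which is closed by compactness;
  -- extending it there means that the pullback extends `f`.
  refine TopologicalSpace.isOpen_generateFrom_of_mem ⟨α '' D, f ∘ e.symm,
    (hD.isCompact.image hαc).isClosed, Str.IsSubstructure.image hα hDs, ⟨?_, ?_⟩, ?_, ?_⟩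
  · intro o ws w hw
    refine hf.map_op o (e.symm ∘ ws) (e.symm w) (hα.mem_op.1 ?_)
    rw [hval]
    exact (funext fun i => hval (ws i) :
      α ∘ (fun i => ((e.symm ∘ ws) i : A →[L] M)) = fun i => (ws i : C →[L] M)) ▸ hw
  · intro r ws hw
    refine hf.map_rel r (e.symm ∘ ws) (hα.reflect_rel r _ ?_)
    exact (funext fun i => hval (ws i) :
      α ∘ (fun i => ((e.symm ∘ ws) i : A →[L] M)) = fun i => (ws i : C →[L] M)) ▸ hw
  · refine (Topology.IsQuotientMap.of_surjective_continuous e.surjective he).continuous_iff.2 ?_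
    convert hfc
    ext φ
    simp
  · ext x
    constructor
    · intro hx w
      exact (congrArg x.1 (hval w)).symm.trans (hx (e.symm w))
    · intro hx φ
      exact (hx (e φ)).trans (congrArg f (e.symm_apply_apply φ))

/-- If `C^*` is covered by the substructures `A^*` and `B^*`, then an isomorphism `C^δ → A^δ × B^δ`
given by restriction is a homeomorphism for the topologies `δ`. -/
theorem isHomeomorph_deltaTopology [Nonempty A] [Nonempty B] [Nonempty C]
    (hfull : YieldsFullDuality E)
    {α : (A →[L] M) → (C →[L] M)} (hα : Str.IsEmbedding E α) (hαc : Continuous α)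
    {β : (B →[L] M) → (C →[L] M)} (hβ : Str.IsEmbedding E β) (hβc : Continuous β)
    (hcover : ∀ w, w ∈ Set.range α ∨ w ∈ Set.range β)
    (Φ : natExt L M C ≃ natExt L M A × natExt L M B)
    (hΦ : ∀ x, Φ x = (natExtPullback hfull α hα.toIsMorphism x,
      natExtPullback hfull β hβ.toIsMorphism x)) :
    @IsHomeomorph _ _ (deltaTopology E C)
      (@instTopologicalSpaceProd _ _ (deltaTopology E A) (deltaTopology E B)) Φ := by
  let tA : TopologicalSpace (natExt L M A) := deltaTopology E A
  let tB : TopologicalSpace (natExt L M B) := deltaTopology E B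
  let tC : TopologicalSpace (natExt L M C) := deltaTopology E C
  have h1 : Continuous Φ := by
    rw [show ⇑Φ = _ from funext hΦ]
    refine Continuous.prodMk (continuous_generateFrom_iff.2 ?_) (continuous_generateFrom_iff.2 ?_)
    · rintro _ ⟨D, f, hD, hDs, hf, hfc, rfl⟩
      exact isOpen_preimage_natExtPullback hfull hα hαc hD hDs hf hfc
    · rintro _ ⟨D, f, hD, hDs, hf, hfc, rfl⟩
      exact isOpen_preimage_natExtPullback hfull hβ hβc hD hDs hf hfc
  have h2 : Continuous Φ.symm := by
    refine continuous_generateFrom_iff.2 ?_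
    rintro _ ⟨D, f, hD, hDs, hf, hfc, rfl⟩
    -- As the two ranges cover $\mathbf C^*$, extending `f` can be checked separately on the two
    -- parts of `D`.
    have : Φ.symm ⁻¹' extending D f = (extending (α ⁻¹' D) fun φ => f ⟨α φ, φ.2⟩) ×ˢ
        (extending (β ⁻¹' D) fun φ => f ⟨β φ, φ.2⟩) := by
      ext y
      obtain ⟨x, rfl⟩ := Φ.surjective y
      rw [Set.mem_preimage, Φ.symm_apply_apply, hΦ]
      constructor
      · exact fun hx => ⟨fun φ => hx ⟨α φ, φ.2⟩, fun φ => hx ⟨β φ, φ.2⟩⟩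
      · rintro ⟨hx, hx'⟩ ⟨w, hw⟩
        rcases hcover w with ⟨φ, rfl⟩ | ⟨φ, rfl⟩
        · exact hx ⟨φ, hw⟩
        · exact hx' ⟨φ, hw⟩
    rw [this]
    exact (isOpen_extending_comp hα.toIsMorphism hαc hD hDs hf hfc).prod
      (isOpen_extending_comp hβ.toIsMorphism hβc hD hDs hf hfc)
  exact (Homeomorph.mk Φ h1 h2).isHomeomorph

end Delta

end NaturalDuality


/-! ### Assembly of the theorem -/

theorem mainTheorem3 {L : FirstOrder.Language.{v, w}} [L.IsAlgebraic]
    {M : Type u} [L.Structure M] [Finite M] [Nonempty M]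
    [TopologicalSpace M] [DiscreteTopology M]
    (hfin : FiniteType L)
    (E : AlterEgo L M) (hfull : YieldsFullDuality E)
    (A B : Type u) [L.Structure A] [L.Structure B] [Nonempty A] [Nonempty B]
    (hA : MemISP L M A) (hB : MemISP L M B) :
    ∃ (_ : HasBinaryCoproduct (dual E A) (dual E B))
      (_ : HasBinaryCoproduct (flat.obj (dual E A)) (flat.obj (dual E B))),
      ((∃ Φ : natExt L M (A × B) ≃[L] natExt L M A × natExt L M B, IsHomeomorph Φ) ↔
        Nonempty (flat.obj (dual E A ⨿ dual E B) ≅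
          flat.obj (dual E A) ⨿ flat.obj (dual E B))) ∧
      (YieldsLogarithmicDuality E →
        Nonempty (flat.obj (dual E A ⨿ dual E B) ≅
          flat.obj (dual E A) ⨿ flat.obj (dual E B)) ∧
        ∃ Φ : natExt L M (A × B) ≃[L] natExt L M A × natExt L M B, IsHomeomorph Φ ∧
          @IsHomeomorph _ _ (deltaTopology E (A × B))
            (@instTopologicalSpaceProd _ _ (deltaTopology E A) (deltaTopology E B)) Φ) := by
  obtain ⟨hdual⟩ := nonempty_isColimit_dualCofan hfull hA hB
  obtain ⟨hcont⟩ := nonempty_isColimit_contDualCofan (A := A) (B := B) hfull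
  have h1 : HasBinaryCoproduct (dual E A) (dual E B) := HasColimit.mk ⟨_, hdual⟩
  have h2 : HasBinaryCoproduct (flat.obj (dual E A)) (flat.obj (dual E B)) :=
    HasColimit.mk ⟨_, hcont⟩
  have i1 : flat.obj (dual E A ⨿ dual E B) ≅ flat.obj (dual E (A × B)) :=
    flat.mapIso ((colimit.isColimit _).coconePointUniqueUpToIso hdual)
  have i2 : flat.obj (dual E A) ⨿ flat.obj (dual E B) ≅
      contDual E (natExt L M A × natExt L M B) :=
    (colimit.isColimit _).coconePointUniqueUpToIso hcont
  have hiff : (∃ Φ : natExt L M (A × B) ≃[L] natExt L M A × natExt L M B, IsHomeomorph Φ) ↔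
      Nonempty (flat.obj (dual E A ⨿ dual E B) ≅
        flat.obj (dual E A) ⨿ flat.obj (dual E B)) :=
    (exists_homeomorph_iff_nonempty_iso hfull).trans
      ⟨fun ⟨σ⟩ => ⟨i1 ≪≫ σ ≪≫ i2.symm⟩, fun ⟨σ⟩ => ⟨i1.symm ≪≫ σ ≪≫ i2⟩⟩
  refine ⟨h1, h2, hiff, fun hlog => ?_⟩
  have hunion := hlog.isDirectUnion _ _ _ _ _ ⟨hdual⟩
  -- Gluing over the direct union gives existence of extensions, and the covering property gives
  -- uniqueness. The resulting `Φ` is given by restriction, as needed for the topologies `δ`.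
  obtain ⟨Φ, hΦ, hhomeo⟩ := exists_equiv_of_existsUnique (C := A × B) hfull
    hunion.left.toIsMorphism hunion.right.toIsMorphism
    (fun f g hf hg => hunion.exists_extension hf hg)
    (fun k k' _ _ hk1 hk2 => funext fun w => by
      rcases hunion.cover w with ⟨φ, rfl⟩ | ⟨φ, rfl⟩
      · exact congrFun hk1 φ
      · exact congrFun hk2 φ)
  exact ⟨hiff.1 ⟨Φ, hhomeo⟩, Φ, hhomeo, isHomeomorph_deltaTopology hfull hunion.left
    (continuous_precomp fstHom) hunion.right (continuous_precomp sndHom) hunion.cover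
    Φ.toEquiv hΦ⟩
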